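/- A two-party simultaneous quantum message protocol with shared randomness for a function $F:\{0,1\}^n\times\{0,1\}^n\to\{0,1\}$ works as follows. Two parties with inputs $x_1,x_2\in\{0,1\}^n$ share a random string $r$, drawn with probability $\pi(r)$ from a finite set; they share no entanglement. Party $i$ sends a (possibly mixed) quantum state $\rho_i(x_i;r)$ on a finite-dimensional Hilbert space $\mathcal M_i$ to a referee, who does not know $r$ and measures $\mathcal M_1\otimes\mathcal M_2$ with a two-outcome POVM to obtain an output bit. The communication complexity of the protocol is $\log\dim(\mathcal M_1\otimes\mathcal M_2)$, where $\log=\log_2$. The protocol is an exact PSQM (private simultaneous quantum messages) protocol for $F$ if, for all $x_1,x_2$, the referee outputs $F(x_1,x_2)$ with probability $1$ (correctness), and there are quantum states $S_0,S_1$ on $\mathcal M_1\otimes\mathcal M_2$ such that $\sum_r\pi(r)\,\rho_1(x_1;r)\otimes\rho_2(x_2;r)=S_{F(x_1,x_2)}$ for all $x_1,x_2$ (perfect privacy). **Theorem.** There is a constant $C$ such that for a $(1-o(1))$ fraction (as $n\to\infty$) of the functions $F_n:\{0,1\}^n\times\{0,1\}^n\to\{0,1\}$, every exact two-party PSQM protocol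 with shared randomness for $F_n$ has communication complexity at least $3n-2\log n-C$. By contrast, without the privacy condition, for every $n\ge 0$ every function $F:\{0,1\}^n\times\{0,1\}^n\to\{0,1\}$ has a two-party simultaneous quantum message protocol with shared randomness that outputs $F(x_1,x_2)$ with probability $1$ for all $x_1,x_2$ and has communication complexity at most $2n$. -/

import Mathlib

open Filter Topology
open scoped Kronecker ComplexOrder

/-- A density matrix: a (possibly mixed) quantum state on the Hilbert space with orthonormal
basis indexed by `ι`. -/
def IsDensityMatrix {ι : Type*} [Fintype ι] (ρ : Matrix ι ι ℂ) : Prop :=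
  ρ.PosSemidef ∧ ρ.trace = 1

/-- A POVM with outcomes in `Y`. -/
def IsPOVM {ι Y : Type*} [Fintype ι] [DecidableEq ι] [Fintype Y]
    (E : Y → Matrix ι ι ℂ) : Prop :=
  (∀ y, (E y).PosSemidef) ∧ ∑ y, E y = 1

/-- A two-party simultaneous quantum message protocol with shared randomness (no entanglement):
the parties with inputs `x₁ : X₁` and `x₂ : X₂` share a random `r : Fin numRand`, which has
probability `prob r` (any distribution on a finite set is allowed). Party `i` prepares the state
`msgᵢ xᵢ r` in a register of dimension `dimᵢ`, and the referee measures the joint register with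
the POVM `referee`, whose outcome in `Y` is the output. -/
structure SMPProtocol (X₁ X₂ Y : Type*) [Fintype Y] where
  numRand : ℕ
  prob : Fin numRand → ℝ
  prob_nonneg : ∀ r, 0 ≤ prob r
  prob_sum : ∑ r, prob r = 1
  dim₁ : ℕ
  dim₂ : ℕ
  msg₁ : X₁ → Fin numRand → Matrix (Fin dim₁) (Fin dim₁) ℂ
  msg₂ : X₂ → Fin numRand → Matrix (Fin dim₂) (Fin dim₂) ℂ
  msg₁_density : ∀ x r, IsDensityMatrix (msg₁ x r)
  msg₂_density : ∀ x r, IsDensityMatrix (msg₂ x r)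
  referee : Y → Matrix (Fin dim₁ × Fin dim₂) (Fin dim₁ × Fin dim₂) ℂ
  referee_povm : IsPOVM referee

namespace SMPProtocol

variable {X₁ X₂ Y : Type*} [Fintype Y]

/-- The state of the joint message register received by the referee, who does not know `r`. -/
noncomputable def jointState (P : SMPProtocol X₁ X₂ Y) (x₁ : X₁) (x₂ : X₂) :
    Matrix (Fin P.dim₁ × Fin P.dim₂) (Fin P.dim₁ × Fin P.dim₂) ℂ :=
  ∑ r, (P.prob r : ℂ) • (P.msg₁ x₁ r ⊗ₖ P.msg₂ x₂ r)

/-- The probability that the referee outputs `y` on inputs `x₁`, `x₂`. -/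
noncomputable def outputProb (P : SMPProtocol X₁ X₂ Y) (x₁ : X₁) (x₂ : X₂) (y : Y) : ℝ :=
  (P.referee y * P.jointState x₁ x₂).trace.re

/-- Correctness with error at most `ε`. -/
def IsCorrect (P : SMPProtocol X₁ X₂ Y) (ε : ℝ) (F : X₁ → X₂ → Y) : Prop :=
  ∀ x₁ x₂, 1 - ε ≤ P.outputProb x₁ x₂ (F x₁ x₂)

/-- Perfect privacy: a simulator that is given only the value of `F` outputs exactly the state
received by the referee. -/
def IsPrivate (P : SMPProtocol X₁ X₂ Y) (F : X₁ → X₂ → Y) : Prop :=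
  ∃ S : Y → Matrix (Fin P.dim₁ × Fin P.dim₂) (Fin P.dim₁ × Fin P.dim₂) ℂ,
    (∀ y, IsDensityMatrix (S y)) ∧ ∀ x₁ x₂, S (F x₁ x₂) = P.jointState x₁ x₂

/-- `P` is an `ε`-error two-party private simultaneous quantum messages protocol for `F`, with
shared randomness. -/
def IsPSQM (P : SMPProtocol X₁ X₂ Y) (ε : ℝ) (F : X₁ → X₂ → Y) : Prop :=
  P.IsCorrect ε F ∧ P.IsPrivate F

/-- The communication complexity of a protocol: the total message length in qubits, that is the
binary logarithm of the dimension of the joint register. -/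
noncomputable def comm (P : SMPProtocol X₁ X₂ Y) : ℝ :=
  Real.logb 2 ((P.dim₁ * P.dim₂ : ℕ) : ℝ)

end SMPProtocol

/-- Functions `F : {0,1}ⁿ × {0,1}ⁿ → {0,1}`. -/
abbrev BoolFun (n : ℕ) : Type := (Fin n → Bool) → (Fin n → Bool) → Bool

/-! ### Positive semidefinite matrices and overlaps of states. -/

section Matrices

variable {ι : Type*} [Fintype ι]

/-! Lower bound: let `N = 2 ^ n`. By privacy all inputs with output `b` give one joint state `S b`,
whose purity is at least the inverse of the joint dimension. Hence the overlaps of joint states,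
summed over the separated pairs with output `b`, total at least (number of pairs) / dimension, and
for some `b` there are at least `N ^ 4 / 8` such pairs (`exists_card_separatedPairs`).

The same sum is bounded above by averaging over two independent random strings `r`, `s`. For fixed
`r`, `s` the summand is `A x y * B x' y'`, where `A` and `B` are the overlap matrices of the two
parties' messages. If `F` has distinct rows and distinct columns, correctness makes the messages of
one party under one string mutually orthogonal, so Bessel's inequality makes `A` and `B` doubly
substochastic. Correctness also forces `F x x' = F y y'` wherever `A x y * B x' y'` is nonzero. If
both matrices had off-diagonal mass above `4 * k`, matchings of size `k + 1` in their supports would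
give `(k + 1) ^ 2` coincidences among the values of `F` (`HasSimilarRectangles`). Without these, one
mass is at most `4 * k` and the other at most `N`, so the sum is at most `4 * k * N`
(`sum_mul_off_diag_le`). Therefore the dimension is at least `N ^ 3 / (32 * k)`
(`IsPSQM.card_separatedPairs_le`).

A union bound shows that for `k = 4 * n` all but a fraction `3 / 2 ^ n` of the functions satisfy
these conditions (`ncard_degenerate_le`). For the upper bound, the parties send their inputs. -/

theorem Matrix.PosSemidef.exists_conjTranspose_mul_self {M : Matrix ι ι ℂ} (hM : M.PosSemidef) :
    ∃ C : Matrix ι ι ℂ, M = C.conjTranspose * C := by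
  classical
  open scoped MatrixOrder in
  exact CStarAlgebra.nonneg_iff_eq_star_mul_self.mp hM.nonneg

theorem Matrix.PosSemidef.trace_mul_nonneg {M N : Matrix ι ι ℂ} (hM : M.PosSemidef)
    (hN : N.PosSemidef) : 0 ≤ (M * N).trace := by
  obtain ⟨C, rfl⟩ := hN.exists_conjTranspose_mul_self
  rw [← Matrix.mul_assoc, Matrix.trace_mul_comm, ← Matrix.mul_assoc]
  exact (hM.mul_mul_conjTranspose_same C).trace_nonneg

/-- Writing `M = Dᴴ * D` and `N = Cᴴ * C`, the trace is the squared Hilbert–Schmidt norm of `D *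
Cᴴ`. -/
theorem Matrix.PosSemidef.mul_eq_zero_of_trace {M N : Matrix ι ι ℂ} (hM : M.PosSemidef)
    (hN : N.PosSemidef) (h : (M * N).trace = 0) : M * N = 0 := by
  obtain ⟨C, rfl⟩ := hN.exists_conjTranspose_mul_self
  obtain ⟨D, rfl⟩ := hM.exists_conjTranspose_mul_self
  have h1 : ((D * C.conjTranspose).conjTranspose * (D * C.conjTranspose)).trace = 0 := by
    rw [← h, Matrix.conjTranspose_mul, Matrix.conjTranspose_conjTranspose, Matrix.mul_assoc,
      Matrix.trace_mul_comm]
    simp only [Matrix.mul_assoc]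
  rw [Matrix.trace_conjTranspose_mul_self_eq_zero_iff] at h1
  calc D.conjTranspose * D * (C.conjTranspose * C)
      = D.conjTranspose * (D * C.conjTranspose) * C := by simp only [Matrix.mul_assoc]
    _ = 0 := by simp [h1]

theorem Matrix.PosSemidef.mul_comm_eq_zero {M N : Matrix ι ι ℂ} (hM : M.PosSemidef)
    (hN : N.PosSemidef) (h : M * N = 0) : N * M = 0 := by
  have := congrArg Matrix.conjTranspose h
  rwa [Matrix.conjTranspose_mul, hM.1.eq, hN.1.eq, Matrix.conjTranspose_zero] at this

/-- The Hilbert–Schmidt overlap `tr (M N)` of two Hermitian matrices. -/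
noncomputable def overlap (M N : Matrix ι ι ℂ) : ℝ := (M * N).trace.re

theorem overlap_nonneg {M N : Matrix ι ι ℂ} (hM : M.PosSemidef) (hN : N.PosSemidef) :
    0 ≤ overlap M N :=
  (Complex.le_def.mp (hM.trace_mul_nonneg hN)).1

theorem trace_mul_eq_overlap {M N : Matrix ι ι ℂ} (hM : M.PosSemidef) (hN : N.PosSemidef) :
    (M * N).trace = overlap M N := by
  have h := (Complex.le_def.mp (hM.trace_mul_nonneg hN)).2
  apply Complex.ext <;> simp [overlap, ← h]

theorem overlap_comm (M N : Matrix ι ι ℂ) : overlap M N = overlap N M := by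
  rw [overlap, overlap, Matrix.trace_mul_comm]

theorem mul_eq_zero_of_overlap {M N : Matrix ι ι ℂ} (hM : M.PosSemidef) (hN : N.PosSemidef)
    (h : overlap M N = 0) : M * N = 0 :=
  hM.mul_eq_zero_of_trace hN (by rw [trace_mul_eq_overlap hM hN, h, Complex.ofReal_zero])

theorem overlap_sum_left {κ : Type*} (s : Finset κ) (M : κ → Matrix ι ι ℂ) (N : Matrix ι ι ℂ) :
    overlap (∑ k ∈ s, M k) N = ∑ k ∈ s, overlap (M k) N := by
  simp [overlap, Finset.sum_mul, Matrix.trace_sum]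

theorem overlap_sum_right {κ : Type*} (s : Finset κ) (M : Matrix ι ι ℂ) (N : κ → Matrix ι ι ℂ) :
    overlap M (∑ k ∈ s, N k) = ∑ k ∈ s, overlap M (N k) := by
  simp [overlap, Finset.mul_sum, Matrix.trace_sum]

theorem overlap_smul_smul (a b : ℝ) (M N : Matrix ι ι ℂ) :
    overlap ((a : ℂ) • M) ((b : ℂ) • N) = a * b * overlap M N := by
  simp [overlap, mul_assoc]
  ring

theorem overlap_kronecker {κ : Type*} [Fintype κ] {M M' : Matrix ι ι ℂ} {N N' : Matrix κ κ ℂ}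
    (hM : M.PosSemidef) (hM' : M'.PosSemidef) (hN : N.PosSemidef) (hN' : N'.PosSemidef) :
    overlap (M ⊗ₖ N) (M' ⊗ₖ N') = overlap M M' * overlap N N' := by
  rw [overlap, ← Matrix.mul_kronecker_mul, Matrix.trace_kronecker, trace_mul_eq_overlap hM hM',
    trace_mul_eq_overlap hN hN', ← Complex.ofReal_mul, Complex.ofReal_re]

theorem overlap_self_eq_sum {S : Matrix ι ι ℂ} (hS : S.IsHermitian) :
    overlap S S = ∑ i, ∑ j, ‖S i j‖ ^ 2 := by
  conv_lhs => rw [overlap, ← hS.eq]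
  rw [hS.eq, Matrix.trace, Complex.re_sum]
  refine Finset.sum_congr rfl fun i _ => ?_
  rw [Matrix.diag_apply, Matrix.mul_apply, Complex.re_sum]
  refine Finset.sum_congr rfl fun j _ => ?_
  rw [← hS.apply j i, Complex.star_def, Complex.mul_conj, Complex.ofReal_re, Complex.sq_norm]

/-- The purity of a state is at least the inverse of the dimension. -/
theorem IsDensityMatrix.one_le_card_mul_overlap {S : Matrix ι ι ℂ} (hS : IsDensityMatrix S) :
    1 ≤ (Fintype.card ι : ℝ) * overlap S S := by
  have h1 : (1 : ℝ) ≤ ∑ i, ‖S i i‖ := by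
    have : ‖S.trace‖ ≤ ∑ i, ‖S i i‖ := norm_sum_le _ _
    rwa [hS.2, norm_one] at this
  have h2 : (∑ i, ‖S i i‖) ^ 2 ≤ (Fintype.card ι : ℝ) * ∑ i, ‖S i i‖ ^ 2 := by
    simpa using sq_sum_le_card_mul_sum_sq (s := Finset.univ) (f := fun i => ‖S i i‖)
  have h3 : ∑ i, ‖S i i‖ ^ 2 ≤ overlap S S := by
    rw [overlap_self_eq_sum hS.1.1]
    refine Finset.sum_le_sum fun i _ => ?_
    exact Finset.single_le_sum (f := fun j => ‖S i j‖ ^ 2) (fun j _ => by positivity)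
      (Finset.mem_univ i)
  have h4 := mul_le_mul_of_nonneg_left h3 (Nat.cast_nonneg (α := ℝ) (Fintype.card ι))
  nlinarith

theorem IsDensityMatrix.overlap_self_pos {S : Matrix ι ι ℂ} (hS : IsDensityMatrix S) :
    0 < overlap S S := by
  have h := hS.one_le_card_mul_overlap
  have h0 := overlap_nonneg hS.1 hS.1
  rcases h0.eq_or_lt with h0 | h0
  · rw [← h0, mul_zero] at h; linarith
  · exact h0

/-- The eigenvalues are nonnegative with sum one, hence lie in `[0, 1]`, where `t - t ^ 2` is
nonnegative. -/
theorem IsDensityMatrix.posSemidef_sub_mul_self {S : Matrix ι ι ℂ} (hS : IsDensityMatrix S) :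
    (S - S * S).PosSemidef := by
  classical
  have hH := hS.1.1
  have hnn := hS.1.eigenvalues_nonneg
  have hsum : ∑ i, hH.eigenvalues i = 1 := by
    have := hH.trace_eq_sum_eigenvalues
    rw [hS.2] at this
    have h := congrArg Complex.re this
    simpa using h.symm
  have hle : ∀ i, hH.eigenvalues i ≤ 1 := fun i => by
    rw [← hsum]
    exact Finset.single_le_sum (fun j _ => hnn j) (Finset.mem_univ i)
  set U : Matrix ι ι ℂ := (hH.eigenvectorUnitary : Matrix ι ι ℂ) with hU
  set D : Matrix ι ι ℂ := Matrix.diagonal (fun i => (hH.eigenvalues i : ℂ)) with hD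
  have hspec : S = U * D * U.conjTranspose := by
    have := hH.spectral_theorem
    rw [Unitary.conjStarAlgAut_apply] at this
    exact this
  have hUU : U.conjTranspose * U = 1 := by
    have := Unitary.coe_star_mul_self hH.eigenvectorUnitary
    simpa [Matrix.star_eq_conjTranspose] using this
  have hSS : S - S * S = U * (D - D * D) * U.conjTranspose := by
    have : S * S = U * (D * D) * U.conjTranspose := by
      calc S * S = U * D * (U.conjTranspose * U) * D * U.conjTranspose := by
            conv_lhs => rw [hspec]
            simp only [Matrix.mul_assoc]
        _ = _ := by rw [hUU]; simp only [Matrix.mul_assoc, Matrix.one_mul]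
    rw [this, Matrix.mul_sub, Matrix.sub_mul, ← hspec]
  rw [hSS]
  refine Matrix.PosSemidef.mul_mul_conjTranspose_same ?_ U
  rw [hD, Matrix.diagonal_mul_diagonal, Matrix.diagonal_sub]
  refine Matrix.PosSemidef.diagonal fun i => ?_
  have : (hH.eigenvalues i : ℂ) - hH.eigenvalues i * hH.eigenvalues i
      = ((hH.eigenvalues i * (1 - hH.eigenvalues i) : ℝ) : ℂ) := by push_cast; ring
  rw [this]
  exact Complex.zero_le_real.mpr (mul_nonneg (hnn i) (by linarith [hle i]))

/-- A Bessel-type inequality: the overlaps of a state with mutually orthogonal states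
sum to at most one. -/
theorem IsDensityMatrix.sum_overlap_le_one {κ : Type*} [Fintype κ] {ρ : κ → Matrix ι ι ℂ}
    (hρ : ∀ k, IsDensityMatrix (ρ k)) (horth : Pairwise fun k l => ρ k * ρ l = 0)
    {σ : Matrix ι ι ℂ} (hσ : IsDensityMatrix σ) : ∑ k, overlap (ρ k) σ ≤ 1 := by
  classical
  set S := ∑ k, ρ k with hS
  have hSS : S * S = ∑ k, ρ k * ρ k := by
    rw [hS, Finset.sum_mul_sum]
    refine Finset.sum_congr rfl fun k _ => ?_
    exact Finset.sum_eq_single k (fun l _ hl => horth hl.symm) (by simp)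
  have hpos : (S - S * S).PosSemidef := by
    rw [hSS, hS, ← Finset.sum_sub_distrib]
    exact Matrix.posSemidef_sum _ fun k _ => (hρ k).posSemidef_sub_mul_self
  have hSH : S.IsHermitian := (Matrix.posSemidef_sum _ fun k _ => (hρ k).1).1
  have hsq : ((1 - S) * (1 - S)).PosSemidef := by
    have h1 : (1 - S).conjTranspose = 1 - S := by
      rw [Matrix.conjTranspose_sub, hSH.eq, Matrix.conjTranspose_one]
    have := Matrix.posSemidef_conjTranspose_mul_self (1 - S)
    rwa [h1] at this
  -- `S` is a sum of orthogonal states, so `S - S * S` splits into the positive terms `ρ k - ρ k * ρ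
  -- k`; then `1 - S = (1 - S) ^ 2 + (S - S * S)` is positive.
  have hone : (1 - S).PosSemidef := by
    have := hsq.add hpos
    have h2 : (1 - S) * (1 - S) + (S - S * S) = 1 - S := by noncomm_ring
    rwa [h2] at this
  have h := overlap_nonneg hone hσ.1
  rw [← overlap_sum_left]
  have : overlap (1 - S) σ = 1 - overlap S σ := by
    simp [overlap, Matrix.sub_mul, Matrix.trace_sub, hσ.2]
  linarith

end Matrices

/-! ### Matchings in doubly substochastic matrices. -/

section Matching

variable {X : Type*} [Fintype X]

/-- A greedy matching: if the off-diagonal entries of a doubly substochastic matrix sum to more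
than `4 * k`, then its support contains `k + 1` edges from a set of sources to a disjoint
set of targets. -/
theorem exists_matching_of_lt_sum {A : X → X → ℝ} (hA : ∀ x y, 0 ≤ A x y)
    (hrow : ∀ x, ∑ y, A x y ≤ 1) (hcol : ∀ y, ∑ x, A x y ≤ 1) [DecidableEq X] (k : ℕ)
    (h : 4 * (k : ℝ) < ∑ x, ∑ y, if x ≠ y then A x y else 0) :
    ∃ u v : Fin (k + 1) → X, Function.Injective u ∧ (∀ i j, u i ≠ v j) ∧
      ∀ i, 0 < A (u i) (v i) := by
  suffices H : ∀ m ≤ k + 1, ∃ u v : Fin m → X, Function.Injective u ∧ (∀ i j, u i ≠ v j) ∧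
      ∀ i, 0 < A (u i) (v i) from H _ le_rfl
  intro m
  induction m with
  | zero => exact fun _ => ⟨Fin.elim0, Fin.elim0, fun i => i.elim0, fun i => i.elim0,
      fun i => i.elim0⟩
  | succ m ih =>
    intro hm
    obtain ⟨u, v, hu, huv, hpos⟩ := ih (by omega)
    set T : Finset X := Finset.univ.image u ∪ Finset.univ.image v with hT
    have hTcard : (T.card : ℝ) ≤ 2 * m := by
      have h1 : T.card ≤ m + m := by
        refine (Finset.card_union_le _ _).trans (add_le_add ?_ ?_) <;>
        · refine Finset.card_image_le.trans ?_
          simp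
      have h2 : (T.card : ℝ) ≤ (m : ℝ) + m := by exact_mod_cast h1
      linarith
    obtain ⟨x, y, hx, hy, hxy, hAxy⟩ : ∃ x y, x ∉ T ∧ y ∉ T ∧ x ≠ y ∧ 0 < A x y := by
      -- The at most `2 * m` used vertices cover mass at most `2 * m` by rows and `2 * m` by
      -- columns, and `4 * m ≤ 4 * k`; so some off-diagonal mass avoids them.
      by_contra! hno
      have hle : ∀ x y, (if x ≠ y then A x y else 0) ≤
          (if x ∈ T then A x y else 0) + (if y ∈ T then A x y else 0) := by
        intro x y
        have h0 := hA x y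
        by_cases hx : x ∈ T <;> by_cases hy : y ∈ T <;> by_cases hxy : x = y <;>
          simp [hx, hy, hxy, h0, hA]
        exact hno x y hx hy hxy
      have h1 : ∑ x, ∑ y, (if x ∈ T then A x y else 0) ≤ T.card := by
        calc _ = ∑ x ∈ T, ∑ y, A x y := by
              refine (Finset.sum_subset (Finset.subset_univ T) fun z _ hz => ?_).symm.trans
                (Finset.sum_congr rfl fun z hz => ?_) <;> simp [hz]
          _ ≤ ∑ x ∈ T, (1 : ℝ) := Finset.sum_le_sum fun x _ => hrow x
          _ = T.card := by simp
      have h2 : ∑ x, ∑ y, (if y ∈ T then A x y else 0) ≤ T.card := by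
        rw [Finset.sum_comm]
        calc _ = ∑ y ∈ T, ∑ x, A x y := by
              refine (Finset.sum_subset (Finset.subset_univ T) fun z _ hz => ?_).symm.trans
                (Finset.sum_congr rfl fun z hz => ?_) <;> simp [hz]
          _ ≤ ∑ x ∈ T, (1 : ℝ) := Finset.sum_le_sum fun x _ => hcol x
          _ = T.card := by simp
      have h3 : ∑ x, ∑ y, (if x ≠ y then A x y else 0) ≤ T.card + T.card := by
        refine (Finset.sum_le_sum fun x _ => Finset.sum_le_sum fun y _ => hle x y).trans ?_
        simp only [Finset.sum_add_distrib]
        exact add_le_add h1 h2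
      have h4 : (m : ℝ) ≤ k := by exact_mod_cast (by omega : m ≤ k)
      linarith
    have hxT : (∀ i, u i ≠ x) ∧ ∀ i, v i ≠ x := by
      simpa [hT, not_or] using hx
    have hyT : (∀ i, u i ≠ y) ∧ ∀ i, v i ≠ y := by
      simpa [hT, not_or] using hy
    refine ⟨Fin.cons x u, Fin.cons y v, ?_, ?_, ?_⟩
    · rw [Fin.cons_injective_iff]
      exact ⟨fun ⟨i, hi⟩ => hxT.1 i hi, hu⟩
    · intro i j
      refine Fin.cases ?_ (fun i => ?_) i <;> refine Fin.cases ?_ (fun j => ?_) j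
      · simpa using hxy
      · simpa using (hxT.2 j).symm
      · simpa using hyT.1 i
      · simpa using huv i j
    · intro i
      refine Fin.cases ?_ (fun i => ?_) i
      · simpa using hAxy
      · simpa using hpos i

theorem sum_off_diag_le_card {A : X → X → ℝ} (hA : ∀ x y, 0 ≤ A x y)
    (hrow : ∀ x, ∑ y, A x y ≤ 1) [DecidableEq X] :
    ∑ x, ∑ y, (if x ≠ y then A x y else 0) ≤ Fintype.card X := by
  calc _ ≤ ∑ x, ∑ y, A x y := Finset.sum_le_sum fun x _ => Finset.sum_le_sum fun y _ => by
        split_ifs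
        · exact le_rfl
        · exact hA x y
    _ ≤ ∑ _x : X, (1 : ℝ) := Finset.sum_le_sum fun x _ => hrow x
    _ = Fintype.card X := by simp

/-- `F` takes equal values on two `k × k` families of cells, matched through injective lists of
rows and columns, with disjoint sets of source rows and target rows. -/
def HasSimilarRectangles {X : Type*} (F : X → X → Bool) (k : ℕ) : Prop :=
  ∃ u v u' v' : Fin k → X, Function.Injective u ∧ (∀ i j, u i ≠ v j) ∧ Function.Injective u' ∧
    ∀ i j, F (u i) (u' j) = F (v i) (v' j)

/-- If both factors exceed `4 * k`, matchings in the two supports yield similar rectangles through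
`hAB`. Otherwise one factor is at most `4 * k`, and the other is at most the cardinality by the row
sums. -/
theorem sum_mul_off_diag_le {F : X → X → Bool} {k : ℕ} (hF : ¬ HasSimilarRectangles F (k + 1))
    {A B : X → X → ℝ} (hA : ∀ x y, 0 ≤ A x y) (hB : ∀ x y, 0 ≤ B x y)
    (hArow : ∀ x, ∑ y, A x y ≤ 1) (hAcol : ∀ y, ∑ x, A x y ≤ 1)
    (hBrow : ∀ x, ∑ y, B x y ≤ 1) (hBcol : ∀ y, ∑ x, B x y ≤ 1)
    (hAB : ∀ x y x' y', F x x' ≠ F y y' → A x y * B x' y' = 0) [DecidableEq X] :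
    (∑ x, ∑ y, if x ≠ y then A x y else 0) * (∑ x, ∑ y, if x ≠ y then B x y else 0)
      ≤ 4 * k * Fintype.card X := by
  have hA0 : 0 ≤ ∑ x, ∑ y, if x ≠ y then A x y else 0 :=
    Finset.sum_nonneg fun x _ => Finset.sum_nonneg fun y _ => by split_ifs <;> simp [hA]
  have hB0 : 0 ≤ ∑ x, ∑ y, if x ≠ y then B x y else 0 :=
    Finset.sum_nonneg fun x _ => Finset.sum_nonneg fun y _ => by split_ifs <;> simp [hB]
  have hA1 := sum_off_diag_le_card hA hArow
  have hB1 := sum_off_diag_le_card hB hBrow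
  by_cases h1 : 4 * (k : ℝ) < ∑ x, ∑ y, if x ≠ y then A x y else 0
  · by_cases h2 : 4 * (k : ℝ) < ∑ x, ∑ y, if x ≠ y then B x y else 0
    · obtain ⟨u, v, hu, huv, hpos⟩ := exists_matching_of_lt_sum hA hArow hAcol k h1
      obtain ⟨u', v', hu', -, hpos'⟩ := exists_matching_of_lt_sum hB hBrow hBcol k h2
      refine absurd ⟨u, v, u', v', hu, huv, hu', fun i j => ?_⟩ hF
      by_contra hne
      exact (mul_pos (hpos i) (hpos' j)).ne' (hAB _ _ _ _ hne)
    · rw [mul_comm]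
      exact mul_le_mul (not_lt.mp h2) hA1 hA0 (by positivity)
  · exact mul_le_mul (not_lt.mp h1) hB1 hB0 (by positivity)

end Matching

/-! ### Counting the exceptional functions. -/

section Counting

/-- The functions that are invariant under a map `τ` from `D` to the complement of `D` are
determined by their values outside `D`. -/
theorem card_invariant_mul_two_pow_le {α : Type*} [Fintype α] [DecidableEq α] (D : Finset α)
    (τ : α → α) (hτ : ∀ a ∈ D, τ a ∉ D) :
    {f : α → Bool | ∀ a ∈ D, f a = f (τ a)}.ncard * 2 ^ D.card ≤ 2 ^ Fintype.card α := by
  have h1 : {f : α → Bool | ∀ a ∈ D, f a = f (τ a)}.ncard ≤ 2 ^ (Fintype.card α - D.card) := by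
    have hinj : Set.InjOn (fun (f : α → Bool) (a : {a // a ∉ D}) => f a)
        {f : α → Bool | ∀ a ∈ D, f a = f (τ a)} := by
      intro f hf g hg hfg
      funext a
      by_cases ha : a ∈ D
      · rw [hf a ha, hg a ha]
        exact congrFun hfg ⟨τ a, hτ a ha⟩
      · exact congrFun hfg ⟨a, ha⟩
    have := Set.ncard_le_ncard_of_injOn (t := Set.univ) _ (fun _ _ => Set.mem_univ _) hinj
    rw [Set.ncard_univ, Nat.card_eq_fintype_card] at this
    simpa [Fintype.card_subtype_compl] using this
  calc _ ≤ 2 ^ (Fintype.card α - D.card) * 2 ^ D.card := Nat.mul_le_mul_right _ h1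
    _ = 2 ^ Fintype.card α := by rw [← pow_add, Nat.sub_add_cancel (Finset.card_le_univ D)]

variable {X : Type*} [Fintype X] [DecidableEq X]

theorem card_invariant_curried_mul_two_pow_le (D : Finset (X × X)) (τ : X × X → X × X)
    (hτ : ∀ a ∈ D, τ a ∉ D) :
    {F : X → X → Bool | ∀ a ∈ D, F a.1 a.2 = F (τ a).1 (τ a).2}.ncard * 2 ^ D.card
      ≤ Nat.card (X → X → Bool) := by
  have h := card_invariant_mul_two_pow_le D τ hτ
  have h1 : Nat.card (X → X → Bool) = 2 ^ Fintype.card (X × X) := by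
    rw [← Nat.card_congr (Equiv.curry X X Bool)]; simp
  rw [h1]
  refine le_trans (Nat.mul_le_mul_right _ ?_) h
  refine Set.ncard_le_ncard_of_injOn (fun F a => F a.1 a.2) (fun F hF => hF) ?_
  intro F _ G _ hFG
  funext x y
  exact congrFun hFG (x, y)

theorem ncard_iUnion_mul_le {ι β : Type*} [Fintype ι] [Finite β] (S : ι → Set β) (c N : ℕ)
    (h : ∀ i, (S i).ncard * c ≤ N) : (⋃ i, S i).ncard * c ≤ Fintype.card ι * N := by
  have h1 : (⋃ i, S i).ncard ≤ ∑ i, (S i).ncard := by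
    simpa using Set.ncard_iUnion_le_of_fintype S
  calc _ ≤ (∑ i, (S i).ncard) * c := Nat.mul_le_mul_right _ h1
    _ = ∑ i, (S i).ncard * c := Finset.sum_mul ..
    _ ≤ ∑ _i : ι, N := Finset.sum_le_sum fun i _ => h i
    _ = _ := by simp

/-- Union bound over the four lists. For fixed lists the `k * k` source cells are distinct, and no
target cell is a source cell because their rows differ; the values on the source cells are thus
determined by the others. -/
theorem card_hasSimilarRectangles_mul_le (k : ℕ) :
    {F : X → X → Bool | HasSimilarRectangles F k}.ncard * 2 ^ (k * k)
      ≤ Fintype.card X ^ (4 * k) * Nat.card (X → X → Bool) := by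
  let S : (Fin k → X) × (Fin k → X) × (Fin k → X) × (Fin k → X) → Set (X → X → Bool) :=
    fun p => {F | Function.Injective p.1 ∧ (∀ i j, p.1 i ≠ p.2.1 j) ∧
      Function.Injective p.2.2.1 ∧ ∀ i j, F (p.1 i) (p.2.2.1 j) = F (p.2.1 i) (p.2.2.2 j)}
  have hS : {F : X → X → Bool | HasSimilarRectangles F k} = ⋃ p, S p := by
    ext F
    simp [S, HasSimilarRectangles]
  have hcard : Fintype.card ((Fin k → X) × (Fin k → X) × (Fin k → X) × (Fin k → X))
      = Fintype.card X ^ (4 * k) := by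
    simp only [Fintype.card_prod, Fintype.card_fun, Fintype.card_fin]
    ring
  rw [hS, ← hcard]
  refine ncard_iUnion_mul_le S _ _ ?_
  rintro ⟨u, v, u', v'⟩
  by_cases hp : Function.Injective u ∧ (∀ i j, u i ≠ v j) ∧ Function.Injective u'
  · obtain ⟨hu, huv, hu'⟩ := hp
    let e : Fin k × Fin k ↪ X × X := ⟨fun p => (u p.1, u' p.2), fun p q hpq => by
      simp only [Prod.mk.injEq] at hpq
      exact Prod.ext (hu hpq.1) (hu' hpq.2)⟩
    -- The default `id` is irrelevant: `τ` is only evaluated on the range of `e`.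
    let τ : X × X → X × X := Function.extend e (fun p => (v p.1, v' p.2)) id
    have hτe : ∀ p, τ (e p) = (v p.1, v' p.2) := fun p => e.injective.extend_apply _ _ p
    have h := card_invariant_curried_mul_two_pow_le (Finset.univ.map e) τ (by
      intro a ha
      obtain ⟨p, -, rfl⟩ := Finset.mem_map.mp ha
      rw [hτe]
      intro hmem
      obtain ⟨q, -, hq⟩ := Finset.mem_map.mp hmem
      exact huv q.1 p.1 (congrArg Prod.fst hq))
    rw [Finset.card_map, Finset.card_univ, Fintype.card_prod, Fintype.card_fin] at h
    refine le_trans (Nat.mul_le_mul_right _ (Set.ncard_le_ncard ?_)) h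
    rintro F ⟨-, -, -, hF⟩ a ha
    obtain ⟨p, -, rfl⟩ := Finset.mem_map.mp ha
    rw [hτe]
    exact hF p.1 p.2
  · have : S (u, v, u', v') = ∅ := by
      ext F
      simp only [S, Set.mem_ofPred_eq, Set.mem_empty_iff_false, iff_false]
      exact fun h => hp ⟨h.1, h.2.1, h.2.2.1⟩
    rw [this]
    simp

theorem card_not_injective_rows_mul_le :
    {F : X → X → Bool | ¬ Function.Injective F}.ncard * 2 ^ Fintype.card X
      ≤ Fintype.card X ^ 2 * Nat.card (X → X → Bool) := by
  let S : X × X → Set (X → X → Bool) := fun p => {F | p.1 ≠ p.2 ∧ F p.1 = F p.2}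
  have hS : {F : X → X → Bool | ¬ Function.Injective F} = ⋃ p, S p := by
    ext F
    simp [S, Function.Injective, and_comm]
  have hcard : Fintype.card (X × X) = Fintype.card X ^ 2 := by
    rw [Fintype.card_prod, sq]
  rw [hS, ← hcard]
  refine ncard_iUnion_mul_le S _ _ ?_
  rintro ⟨x, y⟩
  by_cases hxy : x = y
  · simp [S, hxy]
  · have h := card_invariant_curried_mul_two_pow_le
      (Finset.univ.map ⟨fun z : X => (x, z), fun _ _ h => congrArg Prod.snd h⟩)
      (fun a => (y, a.2)) (by
        intro a _ hmem
        obtain ⟨z, -, hz⟩ := Finset.mem_map.mp hmem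
        exact hxy (congrArg Prod.fst hz))
    rw [Finset.card_map, Finset.card_univ] at h
    refine le_trans (Nat.mul_le_mul_right _ (Set.ncard_le_ncard ?_)) h
    rintro F ⟨-, hF⟩ a ha
    obtain ⟨z, -, rfl⟩ := Finset.mem_map.mp ha
    exact congrFun hF z

theorem card_not_injective_cols_mul_le :
    {F : X → X → Bool | ¬ Function.Injective (flip F)}.ncard * 2 ^ Fintype.card X
      ≤ Fintype.card X ^ 2 * Nat.card (X → X → Bool) := by
  have h : {F : X → X → Bool | ¬ Function.Injective (flip F)}.ncard
      ≤ {F : X → X → Bool | ¬ Function.Injective F}.ncard :=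
    Set.ncard_le_ncard_of_injOn flip (fun F hF => hF)
      (fun F _ G _ hFG => by simpa [flip_flip] using congrArg flip hFG)
  exact (Nat.mul_le_mul_right _ h).trans card_not_injective_rows_mul_le

end Counting

/-! ### Overlaps of messages in a correct and private protocol. -/

section Protocols

namespace SMPProtocol

theorem jointState_density {X₁ X₂ Y : Type*} [Fintype Y] (P : SMPProtocol X₁ X₂ Y) (x₁ : X₁)
    (x₂ : X₂) : IsDensityMatrix (P.jointState x₁ x₂) := by
  refine ⟨Matrix.posSemidef_sum _ fun r _ => ?_, ?_⟩
  · exact ((P.msg₁_density x₁ r).1.kronecker (P.msg₂_density x₂ r).1).smul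
      (Complex.zero_le_real.mpr (P.prob_nonneg r))
  · rw [jointState, Matrix.trace_sum]
    simp only [Matrix.trace_smul, Matrix.trace_kronecker, (P.msg₁_density _ _).2,
      (P.msg₂_density _ _).2, mul_one, smul_eq_mul, ← Complex.ofReal_sum, P.prob_sum,
      Complex.ofReal_one]

theorem overlap_jointState {X₁ X₂ Y : Type*} [Fintype Y] (P : SMPProtocol X₁ X₂ Y)
    (x y : X₁) (x' y' : X₂) :
    overlap (P.jointState x x') (P.jointState y y') = ∑ r, ∑ s, P.prob r * P.prob s *
      (overlap (P.msg₁ x r) (P.msg₁ y s) * overlap (P.msg₂ x' r) (P.msg₂ y' s)) := by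
  simp only [jointState]
  rw [overlap_sum_left]
  refine Finset.sum_congr rfl fun r _ => ?_
  rw [overlap_sum_right]
  refine Finset.sum_congr rfl fun s _ => ?_
  rw [overlap_smul_smul, overlap_kronecker (P.msg₁_density _ _).1 (P.msg₁_density _ _).1
    (P.msg₂_density _ _).1 (P.msg₂_density _ _).1]

variable {X₁ X₂ : Type*} {P : SMPProtocol X₁ X₂ Bool} {F : X₁ → X₂ → Bool}

theorem IsCorrect.referee_mul_jointState (hP : P.IsCorrect 0 F) {x : X₁} {x' : X₂} {b : Bool}
    (hb : F x x' ≠ b) : P.referee b * P.jointState x x' = 0 := by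
  have hρ := P.jointState_density x x'
  have hE := P.referee_povm
  refine mul_eq_zero_of_overlap (hE.1 b) hρ.1 (le_antisymm ?_ (overlap_nonneg (hE.1 b) hρ.1))
  have h1 : 1 ≤ overlap (P.referee (F x x')) (P.jointState x x') := by
    have h := hP x x'
    rwa [sub_zero] at h
  have h2 : overlap (P.referee b) (P.jointState x x')
      + overlap (P.referee (F x x')) (P.jointState x x') = 1 := by
    have hb' : F x x' = !b := by cases b <;> simpa using hb
    have h3 := overlap_sum_left Finset.univ P.referee (P.jointState x x')
    rw [hE.2, Fintype.sum_bool] at h3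
    have h4 : overlap 1 (P.jointState x x') = 1 := by simp [overlap, hρ.2]
    rw [hb']
    cases b <;> simp only [Bool.not_true, Bool.not_false] <;> linarith
  linarith

/-- Inputs with different outputs lead to orthogonal states of the joint register. -/
theorem IsCorrect.overlap_jointState_eq_zero (hP : P.IsCorrect 0 F) {x y : X₁} {x' y' : X₂}
    (h : F x x' ≠ F y y') : overlap (P.jointState x x') (P.jointState y y') = 0 := by
  have h1 := hP.referee_mul_jointState (b := F y y') h
  have h2 := hP.referee_mul_jointState (b := F x x') h.symm
  have h3 := (P.referee_povm.1 _).mul_comm_eq_zero (P.jointState_density x x').1 h1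
  have hE : P.referee (F x x') + P.referee (F y y') = 1 := by
    have := P.referee_povm.2
    rw [Fintype.sum_bool] at this
    cases hx : F x x' <;> cases hy : F y y' <;> simp_all [add_comm]
  -- Inserting the two POVM elements between the states, each annihilates one of them.
  rw [overlap, ← Matrix.mul_one (P.jointState x x'), ← hE, Matrix.mul_add, Matrix.add_mul,
    Matrix.mul_assoc, h2, h3]
  simp

/-- The vanishing overlap of the joint states is a sum of nonnegative terms over `r` and `s`, so
each term vanishes. -/
theorem IsCorrect.overlap_msg_mul (hP : P.IsCorrect 0 F) {r s : Fin P.numRand}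
    (hr : P.prob r ≠ 0) (hs : P.prob s ≠ 0) {x y : X₁} {x' y' : X₂} (h : F x x' ≠ F y y') :
    overlap (P.msg₁ x r) (P.msg₁ y s) * overlap (P.msg₂ x' r) (P.msg₂ y' s) = 0 := by
  have h0 := hP.overlap_jointState_eq_zero h
  have hnn : ∀ r s, 0 ≤ P.prob r * P.prob s *
      (overlap (P.msg₁ x r) (P.msg₁ y s) * overlap (P.msg₂ x' r) (P.msg₂ y' s)) := fun r s =>
    mul_nonneg (mul_nonneg (P.prob_nonneg r) (P.prob_nonneg s))
      (mul_nonneg (overlap_nonneg (P.msg₁_density _ _).1 (P.msg₁_density _ _).1)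
        (overlap_nonneg (P.msg₂_density _ _).1 (P.msg₂_density _ _).1))
  rw [overlap_jointState, Finset.sum_eq_zero_iff_of_nonneg
    fun r _ => Finset.sum_nonneg fun s _ => hnn r s] at h0
  have h1 := h0 r (Finset.mem_univ r)
  rw [Finset.sum_eq_zero_iff_of_nonneg fun s _ => hnn r s] at h1
  exact (mul_eq_zero.mp (h1 s (Finset.mem_univ s))).resolve_left (mul_ne_zero hr hs)

/-- Take equal random strings and a column `z` where rows `x` and `y` differ: the second party's
factor is then a purity, which is positive, so the first factor must vanish. -/
theorem IsCorrect.msg₁_orthogonal (hP : P.IsCorrect 0 F) (hF : Function.Injective F)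
    {r : Fin P.numRand} (hr : P.prob r ≠ 0) :
    Pairwise fun x y => P.msg₁ x r * P.msg₁ y r = 0 := by
  intro x y hxy
  obtain ⟨z, hz⟩ := Function.ne_iff.mp (hF.ne hxy)
  exact mul_eq_zero_of_overlap (P.msg₁_density _ _).1 (P.msg₁_density _ _).1
    ((mul_eq_zero.mp (hP.overlap_msg_mul hr hr hz)).resolve_right
      (P.msg₂_density z r).overlap_self_pos.ne')

theorem IsCorrect.msg₂_orthogonal (hP : P.IsCorrect 0 F) (hF : Function.Injective (flip F))
    {r : Fin P.numRand} (hr : P.prob r ≠ 0) :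
    Pairwise fun x y => P.msg₂ x r * P.msg₂ y r = 0 := by
  intro x y hxy
  obtain ⟨z, hz⟩ := Function.ne_iff.mp (hF.ne hxy)
  exact mul_eq_zero_of_overlap (P.msg₂_density _ _).1 (P.msg₂_density _ _).1
    ((mul_eq_zero.mp (hP.overlap_msg_mul hr hr hz)).resolve_left
      (P.msg₁_density z r).overlap_self_pos.ne')

end SMPProtocol

variable {X : Type*} [Fintype X] [DecidableEq X]

/-- Pairs of inputs with output `b` that differ in both coordinates. -/
def separatedPairs (F : X → X → Bool) (b : Bool) : Finset ((X × X) × (X × X)) :=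
  {p | F p.1.1 p.1.2 = b ∧ F p.2.1 p.2.2 = b ∧ p.1.1 ≠ p.2.1 ∧ p.1.2 ≠ p.2.2}

namespace SMPProtocol

theorem IsCorrect.sum_overlap_msg_le {P : SMPProtocol X X Bool} {F : X → X → Bool}
    (hP : P.IsCorrect 0 F) (hF₁ : Function.Injective F) (hF₂ : Function.Injective (flip F))
    {k : ℕ} (hk : ¬ HasSimilarRectangles F (k + 1)) {r s : Fin P.numRand}
    (hr : P.prob r ≠ 0) (hs : P.prob s ≠ 0) (b : Bool) :
    ∑ p ∈ separatedPairs F b, overlap (P.msg₁ p.1.1 r) (P.msg₁ p.2.1 s) *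
      overlap (P.msg₂ p.1.2 r) (P.msg₂ p.2.2 s) ≤ 4 * k * Fintype.card X := by
  have hA : ∀ x y, 0 ≤ overlap (P.msg₁ x r) (P.msg₁ y s) := fun x y =>
    overlap_nonneg (P.msg₁_density _ _).1 (P.msg₁_density _ _).1
  have hB : ∀ x y, 0 ≤ overlap (P.msg₂ x r) (P.msg₂ y s) := fun x y =>
    overlap_nonneg (P.msg₂_density _ _).1 (P.msg₂_density _ _).1
  refine le_trans ?_ (sum_mul_off_diag_le hk hA hB ?_ ?_ ?_ ?_
    fun x y x' y' h => hP.overlap_msg_mul hr hs h)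
  · calc _ ≤ ∑ p : (X × X) × (X × X),
          (if p.1.1 ≠ p.2.1 then overlap (P.msg₁ p.1.1 r) (P.msg₁ p.2.1 s) else 0) *
          (if p.1.2 ≠ p.2.2 then overlap (P.msg₂ p.1.2 r) (P.msg₂ p.2.2 s) else 0) := by
          rw [separatedPairs, Finset.sum_filter]
          refine Finset.sum_le_sum fun p _ => ?_
          by_cases h1 : p.1.1 = p.2.1 <;> by_cases h2 : p.1.2 = p.2.2 <;>
            simp only [h1, h2, ne_eq, not_true_eq_false, not_false_eq_true, and_false,
              and_true, if_false, if_true, mul_zero, zero_mul, le_refl]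
          split_ifs
          · exact le_rfl
          · exact mul_nonneg (hA _ _) (hB _ _)
      _ = _ := by
          simp only [Fintype.sum_prod_type, Finset.sum_mul_sum]
  -- Row sums use orthogonality under `s`, column sums orthogonality under `r`.
  · intro x
    simp only [overlap_comm (P.msg₁ x r)]
    exact IsDensityMatrix.sum_overlap_le_one (fun y => P.msg₁_density y s)
      (hP.msg₁_orthogonal hF₁ hs) (P.msg₁_density x r)
  · intro y
    exact IsDensityMatrix.sum_overlap_le_one (fun x => P.msg₁_density x r)
      (hP.msg₁_orthogonal hF₁ hr) (P.msg₁_density y s)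
  · intro x
    simp only [overlap_comm (P.msg₂ x r)]
    exact IsDensityMatrix.sum_overlap_le_one (fun y => P.msg₂_density y s)
      (hP.msg₂_orthogonal hF₂ hs) (P.msg₂_density x r)
  · intro y
    exact IsDensityMatrix.sum_overlap_le_one (fun x => P.msg₂_density x r)
      (hP.msg₂_orthogonal hF₂ hr) (P.msg₂_density y s)

/-- Double counting of the total overlap: privacy turns each term into the purity of `S b`, while
expansion over `r` and `s` bounds the total. -/
theorem IsPSQM.card_separatedPairs_le {P : SMPProtocol X X Bool} {F : X → X → Bool}
    (hP : P.IsPSQM 0 F) (hF₁ : Function.Injective F) (hF₂ : Function.Injective (flip F))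
    {k : ℕ} (hk : ¬ HasSimilarRectangles F (k + 1)) (b : Bool) :
    ((separatedPairs F b).card : ℝ) ≤
      ((P.dim₁ * P.dim₂ : ℕ) : ℝ) * (4 * k * Fintype.card X) := by
  obtain ⟨hcorr, S, hS, hSF⟩ := hP
  have hle : ((separatedPairs F b).card : ℝ) * overlap (S b) (S b) ≤ 4 * k * Fintype.card X := by
    calc ((separatedPairs F b).card : ℝ) * overlap (S b) (S b)
        = ∑ p ∈ separatedPairs F b,
          overlap (P.jointState p.1.1 p.1.2) (P.jointState p.2.1 p.2.2) := by
          rw [← nsmul_eq_mul, ← Finset.sum_const]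
          refine Finset.sum_congr rfl fun p hp => ?_
          obtain ⟨h1, h2, -⟩ := (Finset.mem_filter.mp hp).2
          rw [← hSF, ← hSF, h1, h2]
      _ = ∑ r, ∑ s, P.prob r * P.prob s * ∑ p ∈ separatedPairs F b,
            overlap (P.msg₁ p.1.1 r) (P.msg₁ p.2.1 s) *
            overlap (P.msg₂ p.1.2 r) (P.msg₂ p.2.2 s) := by
          simp only [overlap_jointState, Finset.mul_sum]
          rw [Finset.sum_comm]
          refine Finset.sum_congr rfl fun r _ => ?_
          rw [Finset.sum_comm]
      _ ≤ ∑ r, ∑ s, P.prob r * P.prob s * (4 * k * Fintype.card X) := by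
          refine Finset.sum_le_sum fun r _ => Finset.sum_le_sum fun s _ => ?_
          -- Correctness says nothing about strings of probability zero, but their weight removes
          -- them.
          by_cases hr : P.prob r = 0
          · simp [hr]
          by_cases hs : P.prob s = 0
          · simp [hs]
          exact mul_le_mul_of_nonneg_left (hcorr.sum_overlap_msg_le hF₁ hF₂ hk hr hs b)
            (mul_nonneg (P.prob_nonneg r) (P.prob_nonneg s))
      _ = 4 * k * Fintype.card X := by
          simp only [← Finset.sum_mul, ← Finset.mul_sum, P.prob_sum, mul_one, one_mul]
  have hpur := (hS b).one_le_card_mul_overlap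
  simp only [Fintype.card_prod, Fintype.card_fin] at hpur
  have h1 := mul_le_mul_of_nonneg_left hpur (Nat.cast_nonneg (α := ℝ) (separatedPairs F b).card)
  have h2 := mul_le_mul_of_nonneg_left hle (Nat.cast_nonneg (α := ℝ) (P.dim₁ * P.dim₂))
  linarith

end SMPProtocol

/-- One of the two outputs occurs on at least half of the inputs; this gives many separated
pairs. -/
theorem exists_card_separatedPairs (F : X → X → Bool) (hX : 16 ≤ Fintype.card X) :
    ∃ b, (Fintype.card X : ℝ) ^ 4 ≤ 8 * (separatedPairs F b).card := by
  set N := Fintype.card X with hN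
  let I : Bool → Finset (X × X) := fun b => {p | F p.1 p.2 = b}
  have hI : (I true).card + (I false).card = N * N := by
    have h := Finset.card_filter_add_card_filter_not (s := (Finset.univ : Finset (X × X)))
      (fun p => F p.1 p.2 = true)
    simpa [I, hN] using h
  obtain ⟨b, hb⟩ : ∃ b, N * N ≤ 2 * (I b).card := by
    by_contra! h
    have h1 := h true
    have h2 := h false
    omega
  refine ⟨b, ?_⟩
  let E₁ : Finset ((X × X) × (X × X)) := {p | p.1.1 = p.2.1}
  let E₂ : Finset ((X × X) × (X × X)) := {p | p.1.2 = p.2.2}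
  have hE₁ : E₁.card ≤ N ^ 3 := by
    have : E₁.card ≤ Fintype.card (X × X × X) :=
      Finset.card_le_card_of_injOn (t := Finset.univ) (fun p => (p.1.1, p.1.2, p.2.2))
        (fun _ _ => Finset.mem_univ _) (by
          rintro ⟨⟨a, b⟩, c, d⟩ h ⟨⟨a', b'⟩, c', d'⟩ h' heq
          simp_all [E₁])
    simpa [hN, pow_succ, mul_assoc] using this
  have hE₂ : E₂.card ≤ N ^ 3 := by
    have : E₂.card ≤ Fintype.card (X × X × X) :=
      Finset.card_le_card_of_injOn (t := Finset.univ) (fun p => (p.1.1, p.1.2, p.2.1))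
        (fun _ _ => Finset.mem_univ _) (by
          rintro ⟨⟨a, b⟩, c, d⟩ h ⟨⟨a', b'⟩, c', d'⟩ h' heq
          simp_all [E₂])
    simpa [hN, pow_succ, mul_assoc] using this
  have hsub : I b ×ˢ I b ⊆ separatedPairs F b ∪ (E₁ ∪ E₂) := by
    intro p hp
    simp only [I, Finset.mem_product, Finset.mem_filter, Finset.mem_univ, true_and] at hp
    simp only [separatedPairs, E₁, E₂, Finset.mem_union, Finset.mem_filter, Finset.mem_univ,
      true_and, hp]
    tauto
  have hcard : (I b).card * (I b).card ≤ (separatedPairs F b).card + (N ^ 3 + N ^ 3) := by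
    rw [← Finset.card_product]
    refine (Finset.card_le_card hsub).trans ((Finset.card_union_le _ _).trans ?_)
    exact Nat.add_le_add_left ((Finset.card_union_le _ _).trans (add_le_add hE₁ hE₂)) _
  have h1 : N ^ 4 ≤ 4 * ((I b).card * (I b).card) := by
    calc N ^ 4 = (N * N) * (N * N) := by ring
      _ ≤ (2 * (I b).card) * (2 * (I b).card) := Nat.mul_le_mul hb hb
      _ = _ := by ring
  -- The output `b` has at least `N ^ 4 / 4` pairs, and those sharing a coordinate number at most `2
  -- * N ^ 3 ≤ N ^ 4 / 8`.
  have h2 : 16 * N ^ 3 ≤ N ^ 4 := by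
    rw [pow_succ N 3, mul_comm]
    exact Nat.mul_le_mul_left _ hX
  exact_mod_cast (by omega : N ^ 4 ≤ 8 * (separatedPairs F b).card)

end Protocols

/-! ### From dimension to qubits, and the limiting fraction. -/

section Asymptotics

theorem SMPProtocol.IsPSQM.le_comm {n k : ℕ} (hn : 4 ≤ n) {F : BoolFun n}
    (hF₁ : Function.Injective F) (hF₂ : Function.Injective (flip F))
    (hk : ¬ HasSimilarRectangles F (k + 1)) {P : SMPProtocol (Fin n → Bool) (Fin n → Bool) Bool}
    (hP : P.IsPSQM 0 F) (hk0 : 0 < k) :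
    3 * (n : ℝ) - Real.logb 2 k - 5 ≤ P.comm := by
  have hN : Fintype.card (Fin n → Bool) = 2 ^ n := by simp
  obtain ⟨b, hb⟩ := exists_card_separatedPairs F (by
    rw [hN]; exact Nat.pow_le_pow_right (n := 2) (by norm_num) hn)
  have h := hP.card_separatedPairs_le hF₁ hF₂ hk b
  rw [hN] at hb h
  push_cast at hb h
  have hk' : (0 : ℝ) < k := by exact_mod_cast hk0
  have hpow : (0 : ℝ) < 2 ^ n := by positivity
  have h1 : ((2 : ℝ) ^ n) ^ 3 ≤ 2 ^ 5 * k * ((P.dim₁ : ℝ) * P.dim₂) := by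
    refine le_of_mul_le_mul_right ?_ hpow
    calc ((2 : ℝ) ^ n) ^ 3 * 2 ^ n = (2 ^ n) ^ 4 := by ring
      _ ≤ 8 * ((P.dim₁ : ℝ) * P.dim₂ * (4 * k * 2 ^ n)) := hb.trans (by linarith)
      _ = _ := by ring
  have hD : 0 < (P.dim₁ : ℝ) * P.dim₂ := by
    refine pos_of_mul_pos_right (lt_of_lt_of_le (by positivity) h1) (by positivity)
  have h2 := Real.logb_le_logb_of_le (b := 2) (by norm_num) (by positivity) h1
  rw [Real.logb_mul (by positivity) hD.ne', Real.logb_mul (by positivity) hk'.ne',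
    Real.logb_pow, Real.logb_pow, Real.logb_pow, Real.logb_self_eq_one (by norm_num)] at h2
  rw [SMPProtocol.comm]
  push_cast at h2 ⊢
  linarith

theorem three_mul_le_two_pow {n : ℕ} (hn : 4 ≤ n) : 3 * n ≤ 2 ^ n := by
  induction n, hn using Nat.le_induction with
  | base => norm_num
  | succ m hm ih => rw [pow_succ]; omega

theorem ncard_degenerate_le {n : ℕ} (hn : 4 ≤ n) :
    {F : BoolFun n | ¬ (Function.Injective F ∧ Function.Injective (flip F) ∧
      ¬ HasSimilarRectangles F (4 * n + 1))}.ncard * 2 ^ n ≤ 3 * Nat.card (BoolFun n) := by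
  have hN : Fintype.card (Fin n → Bool) = 2 ^ n := by simp
  have hrow := card_not_injective_rows_mul_le (X := Fin n → Bool)
  have hcol := card_not_injective_cols_mul_le (X := Fin n → Bool)
  have hrect := card_hasSimilarRectangles_mul_le (X := Fin n → Bool) (4 * n + 1)
  rw [hN] at hrow hcol hrect
  set T := Nat.card (BoolFun n) with hT
  -- Each union bound has `2 ^ c` cases of density `2 ^ (-d)`; a margin `d - c` of at least `n`
  -- leaves a fraction at most `2 ^ (-n)`.
  have cancel : ∀ {a c d : ℕ}, c + n ≤ d → a * 2 ^ d ≤ 2 ^ c * T → a * 2 ^ n ≤ T := by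
    intro a c d hcd h
    refine Nat.le_of_mul_le_mul_left ?_ (Nat.two_pow_pos c)
    calc 2 ^ c * (a * 2 ^ n) = a * 2 ^ (c + n) := by rw [pow_add]; ring
      _ ≤ a * 2 ^ d := Nat.mul_le_mul_left _ (Nat.pow_le_pow_right (by norm_num) hcd)
      _ ≤ _ := h
  have h3n := three_mul_le_two_pow hn
  rw [← pow_mul] at hrow hcol hrect
  have h1 := cancel (by omega) hrow
  have h2 := cancel (by omega) hcol
  -- The choice `4 * n + 1` gives `(4n + 1) ^ 2 - 4n(4n + 1) = 4n + 1 ≥ n`.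
  have h3 := cancel (by nlinarith) hrect
  have hsub : {F : BoolFun n | ¬ (Function.Injective F ∧ Function.Injective (flip F) ∧
      ¬ HasSimilarRectangles F (4 * n + 1))} ⊆ {F | ¬ Function.Injective F} ∪
      ({F | ¬ Function.Injective (flip F)} ∪ {F | HasSimilarRectangles F (4 * n + 1)}) := by
    intro F hF
    simp only [Set.mem_ofPred_eq, Set.mem_union] at hF ⊢
    tauto
  have h4 := (Set.ncard_le_ncard hsub).trans ((Set.ncard_union_le _ _).trans
    (Nat.add_le_add_left (Set.ncard_union_le _ _) _))
  calc _ ≤ _ * 2 ^ n := Nat.mul_le_mul_right _ h4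
    _ ≤ T + (T + T) := by
      rw [add_mul, add_mul]
      exact add_le_add h1 (add_le_add h2 h3)
    _ = 3 * T := by ring

theorem exists_comm_bound_tendsto :
    ∃ C : ℝ, Tendsto
      (fun n : ℕ =>
        (({F : BoolFun n | ∀ P : SMPProtocol (Fin n → Bool) (Fin n → Bool) Bool,
            P.IsPSQM 0 F → 3 * (n : ℝ) - 2 * Real.logb 2 n - C ≤ P.comm}.ncard : ℕ) : ℝ)
          / (Nat.card (BoolFun n) : ℝ))
      atTop (𝓝 1) := by
  -- `7 = 5 + log 4`: the 5 comes from the factor `32` in the dimension bound, the rest from `k = 4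
  -- * n`.
  refine ⟨7, ?_⟩
  have hlim : Tendsto (fun n : ℕ => 1 - 3 * (1 / 2 : ℝ) ^ n) atTop (𝓝 1) := by
    simpa using ((tendsto_pow_atTop_nhds_zero_of_lt_one (r := (1 / 2 : ℝ)) (by norm_num)
      (by norm_num)).const_mul 3).const_sub 1
  refine tendsto_of_tendsto_of_tendsto_of_le_of_le' hlim tendsto_const_nhds ?_ ?_
  · filter_upwards [eventually_ge_atTop 4] with n hn
    set G : Set (BoolFun n) := {F | Function.Injective F ∧ Function.Injective (flip F) ∧
      ¬ HasSimilarRectangles F (4 * n + 1)} with hG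
    have hTpos : (0 : ℝ) < Nat.card (BoolFun n) := by exact_mod_cast Nat.card_pos
    have hbad : ((Gᶜ).ncard : ℝ) * 2 ^ n ≤ 3 * Nat.card (BoolFun n) := by
      exact_mod_cast ncard_degenerate_le hn
    have hsum : (G.ncard : ℝ) + (Gᶜ).ncard = Nat.card (BoolFun n) := by
      exact_mod_cast Set.ncard_add_ncard_compl G
    have hsub : G ⊆ {F : BoolFun n | ∀ P : SMPProtocol (Fin n → Bool) (Fin n → Bool) Bool,
        P.IsPSQM 0 F → 3 * (n : ℝ) - 2 * Real.logb 2 n - 7 ≤ P.comm} := by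
      rintro F ⟨h1, h2, h3⟩ P hP
      have h := hP.le_comm hn h1 h2 h3 (by omega)
      have hn' : (1 : ℝ) ≤ n := by exact_mod_cast (by omega : 1 ≤ n)
      have hlog : Real.logb 2 ((4 * n : ℕ) : ℝ) = 2 + Real.logb 2 n := by
        push_cast
        rw [Real.logb_mul (by norm_num) (by positivity), show (4 : ℝ) = 2 ^ 2 by norm_num,
          Real.logb_pow, Real.logb_self_eq_one (by norm_num)]
        norm_num
      -- The argument loses only one `log n`; the second is slack.
      have hnn : 0 ≤ Real.logb 2 n := Real.logb_nonneg (by norm_num) hn'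
      rw [hlog] at h
      linarith
    have hle : (G.ncard : ℝ) ≤ ({F : BoolFun n | ∀ P : SMPProtocol (Fin n → Bool)
        (Fin n → Bool) Bool, P.IsPSQM 0 F →
          3 * (n : ℝ) - 2 * Real.logb 2 n - 7 ≤ P.comm}.ncard : ℕ) := by
      exact_mod_cast Set.ncard_le_ncard hsub
    rw [le_div_iff₀ hTpos]
    have h5 : ((Gᶜ).ncard : ℝ) ≤ 3 * (1 / 2) ^ n * Nat.card (BoolFun n) := by
      rw [one_div, inv_pow, mul_right_comm, ← div_eq_mul_inv, le_div_iff₀ (by positivity)]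
      exact hbad
    linarith
  · refine Eventually.of_forall fun n => div_le_one_of_le₀ ?_ (Nat.cast_nonneg _)
    exact_mod_cast Set.ncard_le_card _

end Asymptotics

/-! ### The protocol without privacy. -/

section Classical

theorem isDensityMatrix_diagonal_single {ι : Type*} [Fintype ι] [DecidableEq ι] (i : ι) :
    IsDensityMatrix (Matrix.diagonal (Pi.single i 1 : ι → ℂ)) := by
  refine ⟨Matrix.PosSemidef.diagonal ?_, ?_⟩
  · exact Pi.single_nonneg.mpr zero_le_one
  · simp [Matrix.trace_diagonal]

/-- The protocol in which both parties send their inputs in the computational basis. -/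
noncomputable def sendInputs {n : ℕ} (F : BoolFun n) :
    SMPProtocol (Fin n → Bool) (Fin n → Bool) Bool :=
  let e : (Fin n → Bool) ≃ Fin (2 ^ n) := Fintype.equivFinOfCardEq (by simp)
  { numRand := 1
    prob := fun _ => 1
    prob_nonneg := fun _ => zero_le_one
    prob_sum := by simp
    dim₁ := 2 ^ n
    dim₂ := 2 ^ n
    msg₁ := fun x _ => Matrix.diagonal (Pi.single (e x) 1)
    msg₂ := fun x _ => Matrix.diagonal (Pi.single (e x) 1)
    msg₁_density := fun _ _ => isDensityMatrix_diagonal_single _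
    msg₂_density := fun _ _ => isDensityMatrix_diagonal_single _
    referee := fun b =>
      Matrix.diagonal fun p => if F (e.symm p.1) (e.symm p.2) = b then 1 else 0
    referee_povm := by
      refine ⟨fun b => Matrix.PosSemidef.diagonal fun p => ?_, ?_⟩
      · dsimp only [Pi.zero_apply]
        split_ifs
        · exact zero_le_one
        · exact le_rfl
      · rw [Fintype.sum_bool, Matrix.diagonal_add, ← Matrix.diagonal_one]
        congr 1
        funext p
        cases F (e.symm p.1) (e.symm p.2) <;> simp }

/-- The one-term sum and the coefficient `((1 : ℝ) : ℂ)` are kept so that the left side is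
definitionally the trace in `outputProb` for `sendInputs`. -/
theorem trace_diagonal_mul_smul_kronecker {κ : Type*} [Fintype κ] [DecidableEq κ]
    (f : κ × κ → ℂ) (i j : κ) :
    (Matrix.diagonal f * ∑ _r : Fin 1, ((1 : ℝ) : ℂ) •
      (Matrix.diagonal (Pi.single i 1 : κ → ℂ) ⊗ₖ
        Matrix.diagonal (Pi.single j 1 : κ → ℂ))).trace = f (i, j) := by
  simp [Matrix.diagonal_kronecker_diagonal, Matrix.trace_diagonal, Fintype.sum_prod_type,
    Pi.single_apply]

theorem sendInputs_isCorrect {n : ℕ} (F : BoolFun n) : (sendInputs F).IsCorrect 0 F := by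
  intro x y
  let e : (Fin n → Bool) ≃ Fin (2 ^ n) := Fintype.equivFinOfCardEq (by simp)
  have h : (sendInputs F).outputProb x y (F x y) = 1 := by
    refine (congrArg Complex.re (trace_diagonal_mul_smul_kronecker
      (fun p => if F (e.symm p.1) (e.symm p.2) = F x y then 1 else 0) (e x) (e y))).trans ?_
    simp
  rw [h, sub_zero]

theorem sendInputs_comm {n : ℕ} (F : BoolFun n) : (sendInputs F).comm = 2 * n := by
  have h : ((2 ^ n * 2 ^ n : ℕ) : ℝ) = 2 ^ (2 * n) := by push_cast; ring
  change Real.logb 2 ((2 ^ n * 2 ^ n : ℕ) : ℝ) = 2 * n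
  rw [h, Real.logb_pow, Real.logb_self_eq_one (by norm_num)]
  push_cast
  ring

end Classical

theorem theorem1 :
    (∃ C : ℝ, Tendsto
      (fun n : ℕ =>
        (({F : BoolFun n | ∀ P : SMPProtocol (Fin n → Bool) (Fin n → Bool) Bool,
            P.IsPSQM 0 F → 3 * (n : ℝ) - 2 * Real.logb 2 n - C ≤ P.comm}.ncard : ℕ) : ℝ)
          / (Nat.card (BoolFun n) : ℝ))
      atTop (𝓝 1)) ∧
    (∀ (n : ℕ) (F : BoolFun n), ∃ P : SMPProtocol (Fin n → Bool) (Fin n → Bool) Bool,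
      P.IsCorrect 0 F ∧ P.comm ≤ 2 * (n : ℝ)) :=
  ⟨exists_comm_bound_tendsto,
    fun _ F => ⟨sendInputs F, sendInputs_isCorrect F, (sendInputs_comm F).le⟩⟩
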